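/- Let $d,n\ge 1$. A state is a positive semidefinite complex $d\times d$ matrix of unit trace. A POVM with $n$ outcomes in dimension $d$ is a family $M=(M_1,\dots,M_n)$ of positive semidefinite complex $d\times d$ matrices with $\sum_j M_j=\mathbb 1$. It is extremal if it is an extreme point of the convex set of all $n$-outcome POVMs in dimension $d$, unbiased if all $M_j$ have equal trace, and rank-one if every $M_j$ has rank one. For a state $\rho$, the eavesdropper's (optimal) guessing probability is $$P_{\rm guess}(\rho,M)=\max_{\{p_j,\rho_j\}}\ \sum_{j=1}^n p_j\operatorname{tr}(\rho_j M_j),$$ where the maximum is over all probability distributions $(p_j)_{j=1}^n$ and states $\rho_1,\dots,\rho_n$ with $\sum_{j=1}^n p_j\rho_j=\rho$. The fidelity of $\rho$ and $\sigma$ is $F(\rho,\sigma)=\bigl(\operatorname{tr}\sqrt{\sqrt\rho\,\sigma\sqrt\rho}\bigr)^2$. Theorem. Let $M$ be an unbiased extremal rank-one POVM with $n$ outcomes in dimension $d$, so that $M_j=\frac dn|\psi_j\rangle\langle\psi_j|$ with unit vectors $\psi_j\in\mathbb C^d$, let $\rho$ be a state, and let $\mathcal P$ be the convex hull of $\{|\psi_j\rangle\langle\psi_j|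 : 1\le j\le n\}$. Then both maxima below are attained, and $$P_{\rm guess}(\rho,M)=\frac dn\,\max_{\sigma\in\mathcal P}F(\rho,\sigma).$$ -/

import Mathlib

open scoped MatrixOrder ComplexOrder

noncomputable section

/-- A quantum state in dimension `d`: a positive semidefinite matrix of unit trace. -/
def IsState {d : ℕ} (ρ : Matrix (Fin d) (Fin d) ℂ) : Prop :=
  ρ.PosSemidef ∧ ρ.trace = 1

/-- The set of POVMs with `n` outcomes in dimension `d`: families of `n` positive semidefinite
matrices that sum to the identity. -/
def povms (n d : ℕ) : Set (Fin n → Matrix (Fin d) (Fin d) ℂ) :=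
  {M | (∀ j, (M j).PosSemidef) ∧ ∑ j, M j = 1}

/-- An extremal POVM: a POVM that is not a nontrivial probabilistic mixture of other POVMs. -/
def IsExtremalPOVM {n d : ℕ} (M : Fin n → Matrix (Fin d) (Fin d) ℂ) : Prop :=
  M ∈ Set.extremePoints ℝ (povms n d)

/-- A POVM is unbiased if all of its elements have equal trace. -/
def IsUnbiased {n d : ℕ} (M : Fin n → Matrix (Fin d) (Fin d) ℂ) : Prop :=
  ∀ i j, (M i).trace = (M j).trace

/-- A POVM is rank-one if all of its elements have rank one. -/
def IsRankOne {n d : ℕ} (M : Fin n → Matrix (Fin d) (Fin d) ℂ) : Prop :=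
  ∀ j, (M j).rank = 1

/-- The matrix `|ψ⟩⟨ψ|`. -/
def ketbra {d : ℕ} (ψ : EuclideanSpace ℂ (Fin d)) : Matrix (Fin d) (Fin d) ℂ :=
  Matrix.of fun a b => ψ a * star (ψ b)

/-- The polytope spanned by the matrices `|ψ_j⟩⟨ψ_j|`. -/
def projectorHull {n d : ℕ} (ψ : Fin n → EuclideanSpace ℂ (Fin d)) :
    Set (Matrix (Fin d) (Fin d) ℂ) :=
  convexHull ℝ (Set.range fun j => ketbra (ψ j))

/-- The quantum fidelity `F(ρ, σ) = (tr √(√ρ σ √ρ))²`. The trace is that of a positive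
semidefinite matrix, hence real. -/
def fidelity {d : ℕ} (ρ σ : Matrix (Fin d) (Fin d) ℂ) : ℝ :=
  (CFC.sqrt (CFC.sqrt ρ * σ * CFC.sqrt ρ)).trace.re ^ 2

/-- `(p, τ)` is a probabilistic decomposition of `ρ` into `n` states: `p` is a probability
distribution, every `τ j` is a state, and `∑ j, p j • τ j = ρ`. -/
def IsDecomposition {n d : ℕ} (ρ : Matrix (Fin d) (Fin d) ℂ)
    (p : Fin n → ℝ) (τ : Fin n → Matrix (Fin d) (Fin d) ℂ) : Prop :=
  (∀ j, 0 ≤ p j) ∧ ∑ j, p j = 1 ∧ (∀ j, IsState (τ j)) ∧ ∑ j, p j • τ j = ρ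

/-- The probabilities `∑ j, p j * tr (τ j M j)` with which an eavesdropper can guess the outcome of
`M` on `ρ`, over all decompositions `(p, τ)` of `ρ`. -/
def guessingValues {n d : ℕ} (ρ : Matrix (Fin d) (Fin d) ℂ)
    (M : Fin n → Matrix (Fin d) (Fin d) ℂ) : Set ℝ :=
  {r | ∃ (p : Fin n → ℝ) (τ : Fin n → Matrix (Fin d) (Fin d) ℂ),
    IsDecomposition ρ p τ ∧ r = ∑ j, p j * (τ j * M j).trace.re}

/-- The optimal guessing probability of the eavesdropper. -/
def guessingProbability {n d : ℕ} (ρ : Matrix (Fin d) (Fin d) ℂ)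
    (M : Fin n → Matrix (Fin d) (Fin d) ℂ) : ℝ :=
  sSup (guessingValues ρ M)

end

/-!
Up to the factor `d / n`, the guessing probability is the maximum of `∑ j, ⟨ψ_j, τ_j ψ_j⟩` over all
positive semidefinite `τ_j` with `∑ j, τ_j = ρ`. The theorem compares this quantity with the
fidelities `F(ρ, σ)`, `σ = ∑ j, q_j |ψ_j⟩⟨ψ_j|`, by an Uhlmann-type formula: if `S` is the matrix
with columns `√q_j ψ_j`, so that `S Sᴴ = σ`, then `√F(ρ, σ)` is the maximum of `Re tr (S Φᴴ)` over
all `d × n` matrices `Φ` with `Φ Φᴴ ≤ ρ` (`re_trace_mul_le_trace_sqrt_conj`,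
`exists_trace_mul_eq_trace_sqrt_conj`). Writing `φ_j` for the columns of `Φ`, this trace is
`∑ j, √q_j ⟨φ_j, ψ_j⟩`. The formula itself rests on Douglas' factorization lemma
(`exists_contraction_factor`).

* From `σ` to `τ`: by Cauchy-Schwarz, an optimal `Φ` satisfies
  `F(ρ, σ) ≤ ∑ j, |⟨φ_j, ψ_j⟩|²`. The matrices `|φ_j⟩⟨φ_j|` sum to at most `ρ`, and adding the
  missing part to one of them gives the `τ_j` (`exists_decomposition_of_mem_projectorHull`).
* From `τ` to `σ`: let `w_j = ⟨ψ_j, τ_j ψ_j⟩`. The vector `φ_j = τ_j ψ_j / √w_j` satisfies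
  `|φ_j⟩⟨φ_j| ≤ τ_j` and `⟨φ_j, ψ_j⟩ = √w_j` (`exists_vecMulVec_le`). With weights `q_j`
  proportional to `w_j` the trace equals `√(∑ j, w_j)`, hence `∑ j, w_j ≤ F(ρ, σ)`
  (`exists_mem_projectorHull_le_fidelity`).

The set of guessing values is compact, so its maximum is attained; the two comparisons then show
that the maximal fidelity is attained too, and that the two maxima agree up to the factor `d / n`.
-/

open Matrix

/-! ### Pseudoinverses and Douglas' factorization -/

/-- A Hermitian matrix has a commuting Hermitian generalized inverse, for instance its Moore-Penrose
inverse. -/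
theorem exists_pseudoinverse {d : ℕ} {H : Matrix (Fin d) (Fin d) ℂ} (hH : H.IsHermitian) :
    ∃ G : Matrix (Fin d) (Fin d) ℂ, G.IsHermitian ∧ G * H = H * G ∧ H * G * H = H := by
  have hc (f : ℝ → ℝ) : ContinuousOn f (spectrum ℝ H) :=
    (Matrix.finite_real_spectrum (A := H)).continuousOn f
  have hsa : IsSelfAdjoint H := hH
  have hid : cfc (fun x : ℝ => x) H = H := cfc_id' ℝ H
  -- The identity `x * x⁻¹ * x = x` holds at `x = 0` too, so a kernel of `H` does no harm; every
  -- function is continuous on the finite spectrum.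
  refine ⟨cfc (fun x : ℝ => x⁻¹) H, cfc_predicate _ _, ?_, ?_⟩
  · simpa only [hid] using
      (cfc_commute_cfc (R := ℝ) (fun x => x⁻¹) (fun x => x) H).eq
  · calc H * cfc (fun x : ℝ => x⁻¹) H * H
        = cfc (fun x : ℝ => x) H * cfc (fun x : ℝ => x⁻¹) H * cfc (fun x : ℝ => x) H := by
          rw [hid]
      _ = cfc (fun x : ℝ => x * x⁻¹ * x) H := by
          rw [← cfc_mul _ _ H (hc _) (hc _), ← cfc_mul _ _ H (hc _) (hc _)]
      _ = H := by simp only [mul_inv_mul_cancel]; exact hid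

/-- Douglas' lemma: a matrix `X` with `X Xᴴ ≤ H²` factors as `H U` with a contraction `U`. In the
case of equality `U Uᴴ` acts as the identity on the range of `H`, so that `X = H U` is a polar
decomposition when `H` is positive semidefinite. -/
theorem exists_contraction_factor {d n : ℕ} {H : Matrix (Fin d) (Fin d) ℂ} (hH : H.IsHermitian)
    {X : Matrix (Fin d) (Fin n) ℂ} (hX : X * Xᴴ ≤ H * H) :
    ∃ U : Matrix (Fin d) (Fin n) ℂ, H * U = X ∧ U * Uᴴ ≤ 1 ∧
      (X * Xᴴ = H * H → H * (U * Uᴴ) = H) := by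
  obtain ⟨G, hG, hc, hHGH⟩ := exists_pseudoinverse hH
  have hGHHG : G * (H * H) * G = G * H := by
    calc G * (H * H) * G = G * (H * (H * G)) := by simp only [Matrix.mul_assoc]
      _ = G * (H * G * H) := by rw [Matrix.mul_assoc H G H, hc]
      _ = G * H := by rw [hHGH]
  have hGX : (G * X) * (G * X)ᴴ = G * (X * Xᴴ) * G := by
    rw [conjTranspose_mul, hG.eq]; simp only [Matrix.mul_assoc]
  refine ⟨G * X, ?_, ?_, ?_⟩
  -- `1 - H * G` annihilates `H`, so it annihilates `X` because `X * Xᴴ ≤ H * H`.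
  · have hsa : (1 - H * G)ᴴ = 1 - H * G := by
      rw [conjTranspose_sub, conjTranspose_mul, hG.eq, hH.eq, hc, conjTranspose_one]
    have h0 : (1 - H * G) * H = 0 := by rw [Matrix.sub_mul, hHGH, Matrix.one_mul, sub_self]
    have h1 := (Matrix.le_iff.mp hX).mul_mul_conjTranspose_same (1 - H * G)
    have h2 : (1 - H * G) * (H * H - X * Xᴴ) * (1 - H * G)ᴴ
        = -(((1 - H * G) * X) * ((1 - H * G) * X)ᴴ) := by
      rw [Matrix.mul_sub, ← Matrix.mul_assoc, h0, conjTranspose_mul]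
      simp only [Matrix.zero_mul, zero_sub, Matrix.neg_mul, Matrix.mul_assoc]
    rw [h2] at h1
    have h3 : ((1 - H * G) * X) * ((1 - H * G) * X)ᴴ = 0 :=
      le_antisymm (neg_nonneg.mp h1.nonneg) (posSemidef_self_mul_conjTranspose _).nonneg
    have h4 : (1 - H * G) * X = 0 := self_mul_conjTranspose_eq_zero.mp h3
    rw [Matrix.sub_mul, Matrix.one_mul, sub_eq_zero, Matrix.mul_assoc] at h4
    exact h4.symm
  -- `G * H` is a projection, hence at most `1`.
  · have h1 : (G * X) * (G * X)ᴴ ≤ G * H := by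
      rw [hGX, ← hGHHG, Matrix.le_iff, ← Matrix.sub_mul, ← Matrix.mul_sub]
      simpa only [hG.eq] using (Matrix.le_iff.mp hX).mul_mul_conjTranspose_same G
    refine h1.trans ?_
    have h2 : (1 - G * H) * (1 - G * H)ᴴ = 1 - G * H := by
      rw [conjTranspose_sub, conjTranspose_mul, hG.eq, hH.eq, ← hc, conjTranspose_one,
        Matrix.mul_sub, Matrix.mul_one, Matrix.sub_mul, Matrix.one_mul]
      rw [show G * H * (G * H) = G * (H * G * H) by simp only [Matrix.mul_assoc], hHGH]
      simp
    rw [Matrix.le_iff, ← h2]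
    exact posSemidef_self_mul_conjTranspose _
  · intro h
    rw [hGX, h, hGHHG, ← Matrix.mul_assoc, hHGH]

/-! ### A variational formula for the fidelity -/

theorem trace_mul_nonneg {d : ℕ} {A B : Matrix (Fin d) (Fin d) ℂ} (hA : A.PosSemidef)
    (hB : B.PosSemidef) : 0 ≤ (A * B).trace := by
  obtain ⟨C, rfl⟩ := CStarAlgebra.nonneg_iff_eq_star_mul_self.mp hB.nonneg
  rw [← Matrix.mul_assoc, Matrix.trace_mul_comm, ← Matrix.mul_assoc]
  exact (hA.mul_mul_conjTranspose_same C).trace_nonneg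

/-- The trace norm `tr √(X Xᴴ)` bounds `Re tr (X Uᴴ)` for every contraction `U`. -/
theorem re_trace_mul_le_trace_sqrt {d n : ℕ} (X U : Matrix (Fin d) (Fin n) ℂ)
    (hU : U * Uᴴ ≤ 1) : (X * Uᴴ).trace.re ≤ (CFC.sqrt (X * Xᴴ)).trace.re := by
  set H := CFC.sqrt (X * Xᴴ)
  have hHp : H.PosSemidef := (CFC.sqrt_nonneg _).posSemidef
  have hHH : H * H = X * Xᴴ :=
    CFC.sqrt_mul_sqrt_self _ (posSemidef_self_mul_conjTranspose X).nonneg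
  obtain ⟨W, hW, hW1, -⟩ := exists_contraction_factor hHp.isHermitian hHH.ge
  have key (V : Matrix (Fin d) (Fin n) ℂ) (hV : V * Vᴴ ≤ 1) :
      (H * (V * Vᴴ)).trace.re ≤ H.trace.re := by
    have := trace_mul_nonneg hHp (Matrix.le_iff.mp hV)
    rw [Matrix.mul_sub, Matrix.mul_one, trace_sub, sub_nonneg] at this
    exact (Complex.le_def.mp this).1
  -- Expanding `0 ≤ tr (H (W - U) (W - U)ᴴ)` bounds the cross terms by the diagonal ones.
  have h1 := (Complex.le_def.mp
    (trace_mul_nonneg hHp (posSemidef_self_mul_conjTranspose (W - U)))).1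
  have h2 : (H * (U * Wᴴ)).trace.re = (X * Uᴴ).trace.re := by
    have : (H * (U * Wᴴ))ᴴ = W * Uᴴ * H := by
      simp only [conjTranspose_mul, conjTranspose_conjTranspose, hHp.isHermitian.eq]
    rw [← hW, Matrix.mul_assoc, trace_mul_comm H (W * Uᴴ), ← this, trace_conjTranspose]
    rfl
  have h3 : H * (W * Uᴴ) = X * Uᴴ := by rw [← Matrix.mul_assoc, hW]
  have h4 := key U hU
  have h5 := key W hW1
  rw [conjTranspose_sub, Matrix.sub_mul, Matrix.mul_sub, Matrix.mul_sub, Matrix.mul_sub,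
    Matrix.mul_sub, Matrix.mul_sub, h3] at h1
  simp only [trace_sub, Complex.sub_re, Complex.zero_re, h2] at h1
  linarith

/-- The upper bound in the Uhlmann-type formula: `Re tr (S Φᴴ) ≤ √F(ρ, S Sᴴ)` whenever
`Φ Φᴴ ≤ ρ`. -/
theorem re_trace_mul_le_trace_sqrt_conj {d n : ℕ} {ρ : Matrix (Fin d) (Fin d) ℂ}
    (hρ : ρ.PosSemidef) (S Φ : Matrix (Fin d) (Fin n) ℂ) (hΦ : Φ * Φᴴ ≤ ρ) :
    (S * Φᴴ).trace.re ≤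
      (CFC.sqrt (CFC.sqrt ρ * (S * Sᴴ) * CFC.sqrt ρ)).trace.re := by
  have hR : (CFC.sqrt ρ).IsHermitian := (CFC.sqrt_nonneg ρ).posSemidef.isHermitian
  obtain ⟨U, rfl, hU, -⟩ := exists_contraction_factor hR
    (hΦ.trans_eq (CFC.sqrt_mul_sqrt_self ρ hρ.nonneg).symm)
  have h := re_trace_mul_le_trace_sqrt (CFC.sqrt ρ * S) U hU
  rw [conjTranspose_mul, hR.eq] at h ⊢
  rw [← Matrix.mul_assoc S, trace_mul_comm, ← Matrix.mul_assoc]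
  simpa only [Matrix.mul_assoc] using h

/-- The bound of `re_trace_mul_le_trace_sqrt_conj` is attained. -/
theorem exists_trace_mul_eq_trace_sqrt_conj {d n : ℕ} {ρ : Matrix (Fin d) (Fin d) ℂ}
    (hρ : ρ.PosSemidef) (S : Matrix (Fin d) (Fin n) ℂ) :
    ∃ Φ : Matrix (Fin d) (Fin n) ℂ, Φ * Φᴴ ≤ ρ ∧
      (S * Φᴴ).trace = (CFC.sqrt (CFC.sqrt ρ * (S * Sᴴ) * CFC.sqrt ρ)).trace := by
  set R := CFC.sqrt ρ
  have hR : R.IsHermitian := (CFC.sqrt_nonneg ρ).posSemidef.isHermitian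
  have hX : (R * S) * (R * S)ᴴ = R * (S * Sᴴ) * R := by
    rw [conjTranspose_mul, hR.eq]; simp only [Matrix.mul_assoc]
  set H := CFC.sqrt (R * (S * Sᴴ) * R)
  have hH : H.IsHermitian := (CFC.sqrt_nonneg _).posSemidef.isHermitian
  have hHH : H * H = (R * S) * (R * S)ᴴ := by
    rw [hX]
    exact CFC.sqrt_mul_sqrt_self _ (hX ▸ (posSemidef_self_mul_conjTranspose (R * S)).nonneg)
  obtain ⟨U, hU, hU1, hUH⟩ := exists_contraction_factor hH hHH.ge
  refine ⟨R * U, ?_, ?_⟩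
  · rw [Matrix.le_iff] at hU1 ⊢
    have := hU1.mul_mul_conjTranspose_same R
    rwa [hR.eq, Matrix.mul_sub, Matrix.sub_mul, Matrix.mul_one,
      CFC.sqrt_mul_sqrt_self ρ hρ.nonneg,
      show R * (U * Uᴴ) * R = R * U * (R * U)ᴴ by
        rw [conjTranspose_mul, hR.eq]; simp only [Matrix.mul_assoc]] at this
  · rw [conjTranspose_mul, hR.eq, ← Matrix.mul_assoc, trace_mul_comm, ← Matrix.mul_assoc, ← hU,
      Matrix.mul_assoc, hUH hHH.symm]

/-! ### Rank-one matrices below a positive semidefinite matrix -/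

theorem trace_mul_ketbra {d : ℕ} (τ : Matrix (Fin d) (Fin d) ℂ) (ψ : EuclideanSpace ℂ (Fin d)) :
    (τ * ketbra ψ).trace = star ψ.ofLp ⬝ᵥ τ *ᵥ ψ.ofLp := by
  have h : ketbra ψ = vecMulVec ψ.ofLp (star ψ.ofLp) := rfl
  rw [h, mul_vecMulVec, trace_vecMulVec, dotProduct_comm]

theorem posSemidef_ketbra {d : ℕ} (ψ : EuclideanSpace ℂ (Fin d)) : (ketbra ψ).PosSemidef :=
  posSemidef_vecMulVec_self_star ψ.ofLp

theorem re_trace_mul_ketbra_nonneg {d : ℕ} {τ : Matrix (Fin d) (Fin d) ℂ} (hτ : τ.PosSemidef)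
    (ψ : EuclideanSpace ℂ (Fin d)) : 0 ≤ (τ * ketbra ψ).trace.re :=
  (Complex.le_def.mp (trace_mul_nonneg hτ (posSemidef_ketbra ψ))).1

theorem re_trace_vecMulVec_mul_ketbra {d : ℕ} (φ : Fin d → ℂ) (ψ : EuclideanSpace ℂ (Fin d)) :
    (vecMulVec φ (star φ) * ketbra ψ).trace.re = ‖star φ ⬝ᵥ ψ.ofLp‖ ^ 2 := by
  have h : star ψ.ofLp ⬝ᵥ φ = star (star φ ⬝ᵥ ψ.ofLp) := by rw [star_dotProduct]
  rw [trace_mul_ketbra, vecMulVec_mulVec, dotProduct_smul, h, ← Complex.normSq_eq_norm_sq]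
  simp [Complex.normSq_apply]

/-- A positive semidefinite `τ` can be replaced by a rank-one `|φ⟩⟨φ| ≤ τ` without changing its
expectation value in `ψ`: take `φ = τ ψ / √⟨ψ, τ ψ⟩`. -/
theorem exists_vecMulVec_le {d : ℕ} {τ : Matrix (Fin d) (Fin d) ℂ} (hτ : τ.PosSemidef)
    (ψ : EuclideanSpace ℂ (Fin d)) :
    ∃ φ : Fin d → ℂ, vecMulVec φ (star φ) ≤ τ ∧
      star φ ⬝ᵥ ψ.ofLp = (√(τ * ketbra ψ).trace.re : ℝ) := by
  set v := (τ * ketbra ψ).trace.re with hv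
  have hv0 : 0 ≤ v := re_trace_mul_ketbra_nonneg hτ ψ
  rcases hv0.eq_or_lt with h0 | hpos
  · exact ⟨0, by simpa using hτ.nonneg, by simp [← h0]⟩
  set x := ψ.ofLp
  have hx : star (τ *ᵥ x) ⬝ᵥ x = (v : ℂ) := by
    rw [star_mulVec, hτ.isHermitian.eq, ← dotProduct_mulVec, ← trace_mul_ketbra]
    exact Complex.ext rfl (Complex.nonneg_iff.mp (trace_mul_nonneg hτ (posSemidef_ketbra ψ))).2.symm
  have hvc : (v : ℂ) ≠ 0 := by exact_mod_cast hpos.ne'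
  set N := (v : ℂ)⁻¹ • vecMulVec (τ *ᵥ x) (star (τ *ᵥ x)) with hN
  set K := (v : ℂ)⁻¹ • vecMulVec x (star (τ *ᵥ x)) with hK
  have hτK : τ * K = N := by rw [hK, hN, Matrix.mul_smul, mul_vecMulVec]
  have hNh : Nᴴ = N := by
    rw [hN, conjTranspose_smul, conjTranspose_vecMulVec, star_star]; simp
  have hKτ : Kᴴ * τ = N := by
    rw [← hNh, ← hτK, conjTranspose_mul, hτ.isHermitian.eq]
  have hNK : N * K = N := by
    rw [hN, hK, Matrix.smul_mul, Matrix.mul_smul, vecMulVec_mul_vecMulVec, hx, vecMulVec_smul,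
      smul_smul (v : ℂ)⁻¹ (v : ℂ), inv_mul_cancel₀ hvc, one_smul]
  -- `(1 - K)ᴴ * τ * (1 - K) = τ - N`.
  have hle : N ≤ τ := by
    have h := hτ.conjTranspose_mul_mul_same (1 - K)
    rwa [conjTranspose_sub, conjTranspose_one, Matrix.sub_mul, Matrix.one_mul, hKτ,
      Matrix.mul_sub, Matrix.mul_one, Matrix.sub_mul, hτK, hNK, sub_self, sub_zero] at h
  have hs : (√v : ℂ) ≠ 0 := by exact_mod_cast (Real.sqrt_pos.mpr hpos).ne'
  have hss : (√v : ℂ) * √v = v := by exact_mod_cast Real.mul_self_sqrt hv0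
  refine ⟨(√v : ℂ)⁻¹ • (τ *ᵥ x), ?_, ?_⟩
  · convert hle using 1
    rw [hN, star_smul, smul_vecMulVec, vecMulVec_smul, smul_smul, ← hss]
    simp
  · rw [star_smul, smul_dotProduct, hx, ← hss]
    simp [hs]

/-! ### Ensembles of the vectors `ψ j` -/

/-- The `d × n` matrix with columns `√(q j) ψ j`, a square root of the mixture of the projectors
`|ψ j⟩⟨ψ j|` with weights `q`: see `ensembleMatrix_mul_conjTranspose`. -/
noncomputable def ensembleMatrix {n d : ℕ} (ψ : Fin n → EuclideanSpace ℂ (Fin d)) (q : Fin n → ℝ) :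
    Matrix (Fin d) (Fin n) ℂ :=
  Matrix.of fun a j => (√(q j) : ℂ) * ψ j a

theorem ensembleMatrix_mul_conjTranspose {n d : ℕ} (ψ : Fin n → EuclideanSpace ℂ (Fin d))
    {q : Fin n → ℝ} (hq : ∀ j, 0 ≤ q j) :
    ensembleMatrix ψ q * (ensembleMatrix ψ q)ᴴ = ∑ j, q j • ketbra (ψ j) := by
  ext a b
  rw [mul_apply, Matrix.sum_apply]
  refine Finset.sum_congr rfl fun j _ => ?_
  have hss : (√(q j) : ℂ) * √(q j) = q j := by exact_mod_cast Real.mul_self_sqrt (hq j)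
  simp only [ensembleMatrix, ketbra, conjTranspose_apply, of_apply, Matrix.smul_apply, star_mul',
    Complex.real_smul, ← hss, RCLike.star_def, Complex.conj_ofReal]
  ring

theorem trace_ensembleMatrix_mul {n d : ℕ} (ψ : Fin n → EuclideanSpace ℂ (Fin d))
    (q : Fin n → ℝ) (Φ : Matrix (Fin d) (Fin n) ℂ) :
    (ensembleMatrix ψ q * Φᴴ).trace = ∑ j, (√(q j) : ℂ) * (star (Φ.col j) ⬝ᵥ (ψ j).ofLp) := by
  rw [trace_mul_comm]
  refine Finset.sum_congr rfl fun j _ => ?_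
  simp only [diag_apply, mul_apply, ensembleMatrix, dotProduct, Finset.mul_sum, of_apply,
    conjTranspose_apply, Pi.star_apply, col_apply]
  exact Finset.sum_congr rfl fun a _ => by ring

theorem mul_conjTranspose_eq_sum_vecMulVec {d n : ℕ} (Φ : Matrix (Fin d) (Fin n) ℂ) :
    Φ * Φᴴ = ∑ j, vecMulVec (Φ.col j) (star (Φ.col j)) := by
  ext a b
  simp [mul_apply, Matrix.sum_apply, vecMulVec_apply]

theorem mem_projectorHull_iff {n d : ℕ} {ψ : Fin n → EuclideanSpace ℂ (Fin d)}
    {σ : Matrix (Fin d) (Fin d) ℂ} :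
    σ ∈ projectorHull ψ ↔
      ∃ q : Fin n → ℝ, (∀ j, 0 ≤ q j) ∧ ∑ j, q j = 1 ∧ σ = ∑ j, q j • ketbra (ψ j) := by
  constructor
  · intro h
    have := convexHull_rangle_single_eq_stdSimplex ℝ (Fin n)
    let L : (Fin n → ℝ) →ₗ[ℝ] Matrix (Fin d) (Fin d) ℂ :=
      Fintype.linearCombination ℝ (fun j => ketbra (ψ j))
    have himg : projectorHull ψ = L '' stdSimplex ℝ (Fin n) := by
      rw [← this, LinearMap.image_convexHull, ← Set.range_comp, projectorHull]
      congr 2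
      ext1 j
      simp [L]
    rw [himg] at h
    obtain ⟨q, hq, rfl⟩ := h
    exact ⟨q, hq.1, hq.2, rfl⟩
  · rintro ⟨q, hq0, hq1, rfl⟩
    exact (convex_convexHull ℝ _).sum_mem (fun j _ => hq0 j) hq1
      fun j _ => subset_convexHull ℝ _ ⟨j, rfl⟩

/-! ### Comparison of fidelities and decompositions -/

/-- Every fidelity with an element of the polytope is bounded by the value of some decomposition
of `ρ`. -/
theorem exists_decomposition_of_mem_projectorHull {n d : ℕ}
    (ψ : Fin n → EuclideanSpace ℂ (Fin d)) {ρ σ : Matrix (Fin d) (Fin d) ℂ}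
    (hρ : ρ.PosSemidef) (hσ : σ ∈ projectorHull ψ) :
    ∃ τ : Fin n → Matrix (Fin d) (Fin d) ℂ, (∀ j, (τ j).PosSemidef) ∧ ∑ j, τ j = ρ ∧
      fidelity ρ σ ≤ ∑ j, (τ j * ketbra (ψ j)).trace.re := by
  obtain ⟨q, hq0, hq1, rfl⟩ := mem_projectorHull_iff.mp hσ
  obtain ⟨Φ, hΦ, htr⟩ := exists_trace_mul_eq_trace_sqrt_conj hρ (ensembleMatrix ψ q)
  rw [ensembleMatrix_mul_conjTranspose ψ hq0, trace_ensembleMatrix_mul] at htr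
  have hn : n ≠ 0 := by rintro rfl; simp at hq1
  let j₀ : Fin n := ⟨0, Nat.pos_of_ne_zero hn⟩
  -- The part of `ρ` that is not exhausted by the columns of `Φ`, assigned to one index.
  let E : Fin n → Matrix (Fin d) (Fin d) ℂ := Pi.single j₀ (ρ - Φ * Φᴴ)
  have hE (j : Fin n) : (E j).PosSemidef := by
    by_cases h : j = j₀
    · subst h; simpa [E] using Matrix.le_iff.mp hΦ
    · simpa [E, h] using PosSemidef.zero
  refine ⟨fun j => vecMulVec (Φ.col j) (star (Φ.col j)) + E j,
    fun j => (posSemidef_vecMulVec_self_star _).add (hE j), ?_, ?_⟩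
  · rw [Finset.sum_add_distrib, ← mul_conjTranspose_eq_sum_vecMulVec, Finset.sum_pi_single']
    simp
  set c : Fin n → ℂ := fun j => star (Φ.col j) ⬝ᵥ (ψ j).ofLp
  have h1 : |(∑ j, (√(q j) : ℂ) * c j).re| ≤ ∑ j, √(q j) * ‖c j‖ := by
    refine (Complex.abs_re_le_norm _).trans ((norm_sum_le _ _).trans_eq ?_)
    simp [abs_of_nonneg, Real.sqrt_nonneg]
  calc fidelity ρ (∑ j, q j • ketbra (ψ j))
      = (∑ j, (√(q j) : ℂ) * c j).re ^ 2 := by rw [fidelity, ← htr]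
    _ ≤ (∑ j, √(q j) * ‖c j‖) ^ 2 := sq_le_sq' (abs_le.mp h1).1 (abs_le.mp h1).2
    _ ≤ (∑ j, √(q j) ^ 2) * ∑ j, ‖c j‖ ^ 2 := Finset.sum_mul_sq_le_sq_mul_sq _ _ _
    _ = ∑ j, ‖c j‖ ^ 2 := by simp only [Real.sq_sqrt (hq0 _), hq1, one_mul]
    _ ≤ _ := by
      refine Finset.sum_le_sum fun j _ => ?_
      rw [Matrix.add_mul, trace_add, Complex.add_re, re_trace_vecMulVec_mul_ketbra]
      exact le_add_of_nonneg_right (re_trace_mul_ketbra_nonneg (hE j) _)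

/-- The value of every decomposition of `ρ` is bounded by the fidelity with some element of the
polytope. -/
theorem exists_mem_projectorHull_le_fidelity {n d : ℕ} (hn : n ≠ 0)
    (ψ : Fin n → EuclideanSpace ℂ (Fin d)) {ρ : Matrix (Fin d) (Fin d) ℂ} (hρ : ρ.PosSemidef)
    {τ : Fin n → Matrix (Fin d) (Fin d) ℂ} (hτ : ∀ j, (τ j).PosSemidef) (hsum : ∑ j, τ j = ρ) :
    ∃ σ ∈ projectorHull ψ, ∑ j, (τ j * ketbra (ψ j)).trace.re ≤ fidelity ρ σ := by
  set w : Fin n → ℝ := fun j => (τ j * ketbra (ψ j)).trace.re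
  have hw0 (j : Fin n) : 0 ≤ w j := re_trace_mul_ketbra_nonneg (hτ j) _
  set v := ∑ j, w j with hv
  -- If all `w j` vanish, any element of the polytope will do.
  rcases (Finset.sum_nonneg fun j _ => hw0 j : 0 ≤ v).eq_or_lt with h0 | hpos
  · exact ⟨_, subset_convexHull ℝ _ ⟨⟨0, Nat.pos_of_ne_zero hn⟩, rfl⟩,
      h0.symm.le.trans (sq_nonneg _)⟩
  have hq0 (j : Fin n) : 0 ≤ w j / v := div_nonneg (hw0 j) hpos.le
  refine ⟨∑ j, (w j / v) • ketbra (ψ j), mem_projectorHull_iff.mpr ⟨_, hq0, ?_, rfl⟩, ?_⟩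
  · rw [← Finset.sum_div, ← hv, div_self hpos.ne']
  choose φ hφ hφψ using fun j => exists_vecMulVec_le (hτ j) (ψ j)
  let Φ : Matrix (Fin d) (Fin n) ℂ := Matrix.of fun a j => φ j a
  have hΦ : Φ * Φᴴ ≤ ρ := by
    rw [mul_conjTranspose_eq_sum_vecMulVec, ← hsum]
    exact Finset.sum_le_sum fun j _ => hφ j
  have h := re_trace_mul_le_trace_sqrt_conj hρ (ensembleMatrix ψ fun j => w j / v) Φ hΦ
  rw [ensembleMatrix_mul_conjTranspose ψ hq0, trace_ensembleMatrix_mul] at h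
  have h2 : (∑ j, (√(w j / v) : ℂ) * (star (Φ.col j) ⬝ᵥ (ψ j).ofLp)).re = √v := by
    have h3 (j : Fin n) : (√(w j / v) : ℂ) * (star (Φ.col j) ⬝ᵥ (ψ j).ofLp)
        = ((w j / √v : ℝ) : ℂ) := by
      have : star (Φ.col j) ⬝ᵥ (ψ j).ofLp = (√(w j) : ℝ) := hφψ j
      rw [this, ← Complex.ofReal_mul, Real.sqrt_div (hw0 j), div_mul_eq_mul_div,
        Real.mul_self_sqrt (hw0 j)]
    simp only [h3, ← Complex.ofReal_sum, Complex.ofReal_re]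
    rw [← Finset.sum_div, ← hv, Real.div_sqrt]
  rw [h2] at h
  calc v = √v ^ 2 := (Real.sq_sqrt hpos.le).symm
    _ ≤ _ := pow_le_pow_left₀ (Real.sqrt_nonneg v) h 2

/-! ### Guessing values -/

theorem isClosed_setOf_posSemidef {d : ℕ} :
    IsClosed {A : Matrix (Fin d) (Fin d) ℂ | A.PosSemidef} := by
  simp only [posSemidef_iff_dotProduct_mulVec, Set.ofPred_and, Set.ofPred_forall]
  refine IsClosed.inter ?_ (isClosed_iInter fun x => ?_)
  · exact isClosed_eq (by fun_prop) continuous_id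
  · exact isClosed_le continuous_const (by fun_prop)

theorem norm_apply_le_re_trace {d : ℕ} {A : Matrix (Fin d) (Fin d) ℂ} (hA : A.PosSemidef)
    (i j : Fin d) : ‖A i j‖ ≤ A.trace.re := by
  have hdiag (i : Fin d) : (A i i).re ≤ A.trace.re := by
    rw [trace, Complex.re_sum]
    exact Finset.single_le_sum (f := fun i => (A.diag i).re)
      (fun k _ => (Complex.le_def.mp hA.diag_nonneg).1) (Finset.mem_univ i)
  obtain ⟨B, hB⟩ := CStarAlgebra.nonneg_iff_eq_star_mul_self.mp hA.nonneg
  have hcol (i : Fin d) : ∑ k, ‖B k i‖ ^ 2 = (A i i).re := by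
    simp [hB, mul_apply, star_eq_conjTranspose, ← Complex.normSq_eq_norm_sq, Complex.normSq_apply]
  have h : ‖A i j‖ ≤ ∑ k, ‖B k i‖ * ‖B k j‖ := by
    rw [hB, mul_apply]
    exact (norm_sum_le _ _).trans_eq (by simp)
  have h2 : ∑ k, ‖B k i‖ * ‖B k j‖ ≤ ∑ k, (‖B k i‖ ^ 2 + ‖B k j‖ ^ 2) / 2 :=
    Finset.sum_le_sum fun k _ => by nlinarith [sq_nonneg (‖B k i‖ - ‖B k j‖)]
  rw [← Finset.sum_div, Finset.sum_add_distrib, hcol, hcol] at h2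
  linarith [hdiag i, hdiag j]

theorem isCompact_setOf_isState {d : ℕ} :
    IsCompact {ρ : Matrix (Fin d) (Fin d) ℂ | IsState ρ} := by
  have hK : IsCompact (Set.univ.pi fun _ => Set.univ.pi fun _ => Metric.closedBall 0 1 :
      Set (Fin d → Fin d → ℂ)) :=
    isCompact_univ_pi fun _ => isCompact_univ_pi fun _ => isCompact_closedBall 0 1
  refine IsCompact.of_isClosed_subset hK ?_ fun ρ hρ i _ j _ => ?_
  · exact isClosed_setOf_posSemidef.inter (isClosed_eq (by fun_prop) continuous_const)
  · rw [mem_closedBall_zero_iff]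
    exact (norm_apply_le_re_trace hρ.1 i j).trans_eq (by rw [hρ.2, Complex.one_re])

theorem isCompact_guessingValues {n d : ℕ} (ρ : Matrix (Fin d) (Fin d) ℂ)
    (M : Fin n → Matrix (Fin d) (Fin d) ℂ) : IsCompact (guessingValues ρ M) := by
  have hK : IsCompact (stdSimplex ℝ (Fin n) ×ˢ
      (Set.univ.pi fun _ : Fin n => {τ : Matrix (Fin d) (Fin d) ℂ | IsState τ})) :=
    (isCompact_stdSimplex ℝ _).prod (isCompact_univ_pi fun _ => isCompact_setOf_isState)
  have hC : IsClosed {x : (Fin n → ℝ) × (Fin n → Matrix (Fin d) (Fin d) ℂ) |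
      ∑ j, x.1 j • x.2 j = ρ} :=
    isClosed_eq (by fun_prop) continuous_const
  have hf : Continuous fun x : (Fin n → ℝ) × (Fin n → Matrix (Fin d) (Fin d) ℂ) =>
      ∑ j, x.1 j * (x.2 j * M j).trace.re := by
    fun_prop
  convert (hK.inter_right hC).image hf using 1
  ext r
  constructor
  · rintro ⟨p, τ, ⟨h1, h2, h3, h4⟩, rfl⟩
    exact ⟨(p, τ), ⟨⟨⟨h1, h2⟩, fun j _ => h3 j⟩, h4⟩, rfl⟩
  · rintro ⟨⟨p, τ⟩, ⟨⟨⟨h1, h2⟩, h3⟩, h4⟩, rfl⟩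
    exact ⟨p, τ, ⟨h1, h2, fun j => h3 j trivial, h4⟩, rfl⟩

/-- A decomposition of `ρ` into unnormalized positive semidefinite matrices gives a guessing value:
its weights are the traces. -/
theorem sum_re_trace_mem_guessingValues {n d : ℕ} {ρ : Matrix (Fin d) (Fin d) ℂ}
    (hρ : IsState ρ) (M : Fin n → Matrix (Fin d) (Fin d) ℂ)
    {τ : Fin n → Matrix (Fin d) (Fin d) ℂ} (hτ : ∀ j, (τ j).PosSemidef) (hsum : ∑ j, τ j = ρ) :
    ∑ j, (τ j * M j).trace.re ∈ guessingValues ρ M := by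
  have hp0 (j : Fin n) : 0 ≤ (τ j).trace.re := (Complex.le_def.mp (hτ j).trace_nonneg).1
  have htr (j : Fin n) : (τ j).trace = ((τ j).trace.re : ℂ) :=
    Complex.ext rfl (Complex.nonneg_iff.mp (hτ j).trace_nonneg).2.symm
  -- If `τ j` has trace zero it vanishes, and any state may be given the weight `0`.
  let ω : Fin n → Matrix (Fin d) (Fin d) ℂ := fun j =>
    if (τ j).trace.re = 0 then ρ else (τ j).trace.re⁻¹ • τ j
  have hω (j : Fin n) : (τ j).trace.re • ω j = τ j := by
    by_cases h : (τ j).trace.re = 0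
    · rw [h, zero_smul, ((hτ j).trace_eq_zero_iff.mp (by rw [htr, h, Complex.ofReal_zero]))]
    · simp only [ω, if_neg h, smul_smul, mul_inv_cancel₀ h, one_smul]
  refine ⟨fun j => (τ j).trace.re, ω, ⟨hp0, ?_, fun j => ?_, ?_⟩, ?_⟩
  · rw [← Complex.re_sum, ← trace_sum, hsum, hρ.2, Complex.one_re]
  · by_cases h : (τ j).trace.re = 0
    · simpa only [ω, if_pos h] using hρ
    · simp only [ω, if_neg h]
      refine ⟨(hτ j).smul (inv_nonneg.mpr (hp0 j)), ?_⟩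
      rw [trace_smul, htr j, Complex.ofReal_re, Complex.real_smul, ← Complex.ofReal_mul,
        inv_mul_cancel₀ h, Complex.ofReal_one]
  · simp only [hω, hsum]
  · refine Finset.sum_congr rfl fun j _ => ?_
    conv_lhs => rw [← hω j]
    rw [Matrix.smul_mul, trace_smul, Complex.real_smul, Complex.re_ofReal_mul]

/-! ### The guessing probability as a maximal fidelity -/

theorem theorem1 {n d : ℕ} (M : Fin n → Matrix (Fin d) (Fin d) ℂ)
    (hext : IsExtremalPOVM M) (hunb : IsUnbiased M) (hrank : IsRankOne M)
    (ψ : Fin n → EuclideanSpace ℂ (Fin d)) (hψ : ∀ j, ‖ψ j‖ = 1)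
    (hM : ∀ j, M j = ((d : ℝ) / (n : ℝ)) • ketbra (ψ j))
    (ρ : Matrix (Fin d) (Fin d) ℂ) (hρ : IsState ρ) :
    IsGreatest (guessingValues ρ M) (guessingProbability ρ M) ∧
      ∃ F : ℝ, IsGreatest (fidelity ρ '' projectorHull ψ) F ∧
        guessingProbability ρ M = (d : ℝ) / (n : ℝ) * F := by
  have hd : d ≠ 0 := by
    rintro rfl
    simpa using hρ.2
  have hn : n ≠ 0 := by
    rintro rfl
    have h1 : (0 : Matrix (Fin d) (Fin d) ℂ) = 1 := by simpa using hext.1.2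
    have h2 := congrArg trace h1
    simp at h2
    exact hd (by exact_mod_cast h2.symm)
  have hc : 0 < (d : ℝ) / n := by positivity
  set c : ℝ := (d : ℝ) / n
  have hval (τ : Fin n → Matrix (Fin d) (Fin d) ℂ) (j : Fin n) :
      (τ j * M j).trace.re = c * (τ j * ketbra (ψ j)).trace.re := by
    rw [hM j, Matrix.mul_smul, trace_smul, Complex.real_smul, Complex.re_ofReal_mul]
  have hupper {σ : Matrix (Fin d) (Fin d) ℂ} (hσ : σ ∈ projectorHull ψ) :
      ∃ r ∈ guessingValues ρ M, c * fidelity ρ σ ≤ r := by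
    obtain ⟨τ, hτ, hsum, hle⟩ := exists_decomposition_of_mem_projectorHull ψ hρ.1 hσ
    refine ⟨_, sum_re_trace_mem_guessingValues hρ M hτ hsum, ?_⟩
    simp only [hval, ← Finset.mul_sum]
    exact mul_le_mul_of_nonneg_left hle hc.le
  have hlower {r : ℝ} (hr : r ∈ guessingValues ρ M) :
      ∃ σ ∈ projectorHull ψ, r ≤ c * fidelity ρ σ := by
    obtain ⟨p, τ, ⟨hp, -, hτ, hsum⟩, rfl⟩ := hr
    obtain ⟨σ, hσ, hle⟩ := exists_mem_projectorHull_le_fidelity hn ψ hρ.1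
      (fun j => (hτ j).1.smul (hp j)) hsum
    refine ⟨σ, hσ, ?_⟩
    refine Eq.trans_le ?_ (mul_le_mul_of_nonneg_left hle hc.le)
    rw [Finset.mul_sum]
    refine Finset.sum_congr rfl fun j _ => ?_
    rw [hval, Matrix.smul_mul, trace_smul, Complex.real_smul, Complex.re_ofReal_mul]
    ring
  have hcomp := isCompact_guessingValues ρ M
  have hne : (guessingValues ρ M).Nonempty :=
    let ⟨r, hr, _⟩ := hupper (subset_convexHull ℝ _ ⟨⟨0, Nat.pos_of_ne_zero hn⟩, rfl⟩)
    ⟨r, hr⟩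
  have hmax : IsGreatest (guessingValues ρ M) (guessingProbability ρ M) := hcomp.isGreatest_sSup hne
  obtain ⟨σ₀, hσ₀, hle⟩ := hlower hmax.1
  have hbound {σ : Matrix (Fin d) (Fin d) ℂ} (hσ : σ ∈ projectorHull ψ) :
      c * fidelity ρ σ ≤ guessingProbability ρ M :=
    let ⟨_, hr, h⟩ := hupper hσ
    h.trans (hmax.2 hr)
  refine ⟨hmax, fidelity ρ σ₀, ⟨⟨σ₀, hσ₀, rfl⟩, ?_⟩, le_antisymm hle (hbound hσ₀)⟩
  rintro _ ⟨σ, hσ, rfl⟩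
  exact le_of_mul_le_mul_left ((hbound hσ).trans hle) hc
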